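/- Let $G$ be a finite group and $m\ge 1$ an integer. Let $V=\bigcup_{i=1}^m G_i$, where the sets $G_i=\{x_i : x\in G\}$ are $m$ disjoint copies of $G$, and let $R(G)=\{R(g):g\in G\}$, where $R(g)$ is the permutation $x_i\mapsto (xg)_i$ of $V$. Let $S_{i,j}\subseteq G$ $(1\le i,j\le m)$ be subsets with $S_{i,i}=\emptyset$ for all $i$. The digraph with vertex set $V$ and arc set $\bigcup_{i,j}\{(x_i,(sx)_j) : x\in G,\ s\in S_{i,j}\}$, when this arc set is symmetric (so that it is a graph; equivalently $S_{j,i}=S_{i,j}^{-1}$ for all $i,j$), is called an $m$-PCayley graph of $G$. An $m$-PCayley graph $\Gamma$ of $G$ is called $m$PCI if, for every $m$-PCayley graph $\Sigma$ of $G$ for which there is a graph isomorphism $\Gamma\to\Sigma$ mapping each $G_i$ onto some $G_j$, there is an element $n$ of the normalizer of $R(G)$ in the symmetric group on $V$ such that $\Gamma^n=\Sigma$, where $\Gamma^n$ denotes the graph on $V$ with arcs $(u^n,v^n)$ for $(u,v)$ an arc of $\Gamma$. The group $G$ is called $m$PCI if every $m$-PCayley graph of $G$ is $m$PCI. Lemma.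 For every integer $m$ with $1\le m\le 5$, the cyclic group $\mathbb{Z}_3$ of order $3$ and the dihedral group $D_6$ of order $6$ are both $m$PCI. -/

import Mathlib

namespace MCayley

variable {G : Type*} [Group G] {m : ℕ}

/-- The arcs of `Cay(G, S i j : i, j)` on the vertex set `⋃ i, G_i`. The vertex `x_i` is the pair
`(i, x)`, and the arcs are the pairs `(x_i, (s x)_j)` with `s ∈ S i j` and `x ∈ G`. -/
def Arc (S : Fin m → Fin m → Set G) (u v : Fin m × G) : Prop :=
  ∃ s ∈ S u.1 v.1, v.2 = s * u.2

/-- `Γ` is an `m`-PCayley graph of `G`: it is `Cay(G, S i j : i, j)` for some subsets `S i j` of `G`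
with all `S i i` empty. Symmetry of the arc set is part of `Γ` being a `SimpleGraph`. -/
def IsMPCayleyGraph (Γ : SimpleGraph (Fin m × G)) : Prop :=
  ∃ S : Fin m → Fin m → Set G, (∀ i, S i i = ∅) ∧ ∀ u v, Γ.Adj u v ↔ Arc S u v

/-- The block `G_i = {x_i : x ∈ G}`. -/
def block (G : Type*) {m : ℕ} (i : Fin m) : Set (Fin m × G) := {u | u.1 = i}

/-- The permutation `R(g) : x_i ↦ (x g)_i`. -/
def rightMul (m : ℕ) (g : G) : Equiv.Perm (Fin m × G) :=
  Equiv.prodCongr (Equiv.refl (Fin m)) (Equiv.mulRight g)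

/-- The permutation group `R(G) = {R(g) : g ∈ G}`. -/
def rightMulGroup (m : ℕ) (G : Type*) [Group G] : Subgroup (Equiv.Perm (Fin m × G)) where
  carrier := Set.range (rightMul m : G → Equiv.Perm (Fin m × G))
  one_mem' := ⟨1, by ext u <;> simp [rightMul]⟩
  mul_mem' := by
    rintro _ _ ⟨g, rfl⟩ ⟨h, rfl⟩
    exact ⟨h * g, by ext u <;> simp [rightMul, mul_assoc]⟩
  inv_mem' := by
    rintro _ ⟨g, rfl⟩
    refine ⟨g⁻¹, (inv_eq_of_mul_eq_one_left ?_).symm⟩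
    ext u <;> simp [rightMul]

/-- The image graph `Γ^π`: its edges are the pairs `{π u, π v}` with `{u, v}` an edge of `Γ`. -/
def image {V : Type*} (π : Equiv.Perm V) (Γ : SimpleGraph V) : SimpleGraph V :=
  Γ.map π

/-- `Γ` and `Γ'` are `p`-isomorphic: some graph isomorphism from `Γ` to `Γ'` maps every block `G_i`
onto some block `G_j`. -/
def PIsomorphic (Γ Γ' : SimpleGraph (Fin m × G)) : Prop :=
  ∃ σ : Γ ≃g Γ', ∀ i : Fin m, ∃ j : Fin m, σ '' block G i = block G j

/-- The `m`-PCayley graph `Γ` is `m`PCI: every `m`-PCayley graph of `G` that is `p`-isomorphic to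
`Γ` is the image of `Γ` under an element of the normalizer of `R(G)` in the symmetric group. -/
def IsMPCIGraph (Γ : SimpleGraph (Fin m × G)) : Prop :=
  ∀ Γ' : SimpleGraph (Fin m × G), IsMPCayleyGraph Γ' → PIsomorphic Γ Γ' →
    ∃ n ∈ Subgroup.normalizer (rightMulGroup m G : Set (Equiv.Perm (Fin m × G))), image n Γ = Γ'

/-- The finite group `G` is `m`PCI: every `m`-PCayley graph of `G` is `m`PCI. -/
def IsMPCIGroup (m : ℕ) (G : Type*) [Group G] [Finite G] : Prop :=
  ∀ Γ : SimpleGraph (Fin m × G), IsMPCayleyGraph Γ → IsMPCIGraph Γ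

end MCayley

/-! The proof is a Babai-type conjugacy argument. Let `K` be the group of automorphisms of `Γ`
fixing every block. If `σ : Γ → Γ'` permutes blocks, then `σ⁻¹ R(G) σ` lies in `K`, as does `R(G)`.
Any `α ∈ K` carrying the first group to the second gives the normalizing element `σ α⁻¹`
(`exists_mem_normalizer_of_conj`).

To find `α`, split each block into cells, the orbits of the element of order 3. By Sylow's theorem
an element `c` of order 3 in `K` can be conjugated to a translation by some `ε l` on each cell `l`
(`exists_conj_translation`). Cells with different `ε` are completely joined or not joined at all
(`uniform_of_ne`), so reflecting all cells with a given `ε` is an automorphism as soon as it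
respects the edges among those cells. Since every subset of `ZMod 3` is invariant under a
reflection, this works for up to two blocks, and among five blocks one of the two signs occurs at
most twice. This makes `ε` constant.

For the dihedral group, `ε` is first made constant on each block (`exists_conj_blockwise`), and the
involution is corrected last. -/

namespace MCayley

open Equiv

/-! ### Elements of order 3: translations, reflections and uniform pairs of cells. -/

section Core

variable {I J : Type*}

/-- The permutations preserving the relation `A` and every block `{u | u.1.1 = i}`. -/
def blockAut (A : (I × J) × ZMod 3 → (I × J) × ZMod 3 → Prop) :
    Subgroup (Perm ((I × J) × ZMod 3)) where
  carrier := {g | (∀ u v, A (g u) (g v) ↔ A u v) ∧ ∀ u, (g u).1.1 = u.1.1}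
  one_mem' := by simp
  mul_mem' := by
    rintro g h ⟨hg, hg'⟩ ⟨hh, hh'⟩
    exact ⟨fun u v => by simp [hg, hh], fun u => by simp [hg', hh']⟩
  inv_mem' := by
    rintro g ⟨hg, hg'⟩
    exact ⟨fun u v => by simpa using (hg (g⁻¹ u) (g⁻¹ v)).symm,
      fun u => by simpa using (hg' (g⁻¹ u)).symm⟩

/-- The translation by `1` in every cell. -/
def shift (I J : Type*) : Perm ((I × J) × ZMod 3) :=
  Equiv.prodCongr (Equiv.refl _) (Equiv.addRight 1)

@[simp] lemma shift_apply (l : I × J) (x : ZMod 3) : shift I J (l, x) = (l, x + 1) := rfl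

@[simp] lemma shift_inv_apply (l : I × J) (x : ZMod 3) :
    (shift I J)⁻¹ (l, x) = (l, x - 1) := by
  rw [Perm.inv_eq_iff_eq]; simp

lemma shift_pow_apply (n : ℕ) (l : I × J) (x : ZMod 3) :
    (shift I J ^ n) (l, x) = (l, x + n) := by
  induction n with
  | zero => simp
  | succ n ih => rw [pow_succ', Perm.mul_apply, ih]; simp [add_assoc]

lemma shift_pow_three : shift I J ^ 3 = 1 := by
  ext1 ⟨l, x⟩
  rw [shift_pow_apply]
  rw [ZMod.natCast_self, add_zero, Perm.one_apply]

/-- An orbit of `P` has 3-power size, contains a cell, and lies in a block of at most 6 points;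
hence it is exactly the cell. -/
lemma fst_apply_of_isPGroup [Finite I] [Fintype J] (hJ : Fintype.card J < 3)
    (P : Subgroup (Perm ((I × J) × ZMod 3))) (hP : IsPGroup 3 P)
    (hb : ∀ g ∈ P, ∀ u, (g u).1.1 = u.1.1) (hs : shift I J ∈ P)
    (g : Perm ((I × J) × ZMod 3)) (hg : g ∈ P) (u : (I × J) × ZMod 3) : (g u).1 = u.1 := by
  classical
  have : Fact (Nat.Prime 3) := ⟨Nat.prime_three⟩
  obtain ⟨n, hn⟩ := hP.card_orbit u
  have h1 : MulAction.orbit P u ⊆ Set.range (fun p : J × ZMod 3 => ((u.1.1, p.1), p.2)) := by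
    rintro _ ⟨⟨p, hp⟩, rfl⟩
    refine ⟨((p u).1.2, (p u).2), ?_⟩
    have := hb p hp u
    simp only [← this]
    rfl
  have h2 : Set.range (fun x : ZMod 3 => (u.1, x)) ⊆ MulAction.orbit P u := by
    rintro _ ⟨x, rfl⟩
    refine ⟨⟨shift I J ^ (x - u.2).val, Subgroup.pow_mem _ hs _⟩, ?_⟩
    change (shift I J ^ (x - u.2).val) (u.1, u.2) = _
    rw [shift_pow_apply]
    simp
  have c1 : (MulAction.orbit P u).ncard < 9 := by
    refine (Set.ncard_le_ncard h1 (Set.finite_range _)).trans_lt ?_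
    rw [Set.ncard_range_of_injective
      (by rintro ⟨a, b⟩ ⟨c, d⟩ h; simpa using h)]
    simp only [Nat.card_eq_fintype_card, Fintype.card_prod, ZMod.card]
    omega
  have c2 : (Set.range (fun x : ZMod 3 => (u.1, x))).ncard = 3 := by
    rw [Set.ncard_range_of_injective (by intro a b h; simpa using h)]
    simp
  have hn' : (MulAction.orbit P u).ncard = 3 ^ n := hn
  have hn1 : n < 2 := by
    by_contra h
    have : 3 ^ 2 ≤ 3 ^ n := Nat.pow_le_pow_right (by norm_num) (by omega)
    omega
  have h3 : (MulAction.orbit P u).ncard ≤ 3 := by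
    rw [hn']; interval_cases n <;> norm_num
  have heq := Set.eq_of_subset_of_ncard_le h2 (by rw [c2]; exact h3) (Set.toFinite _)
  have : g u ∈ MulAction.orbit P u := ⟨⟨g, hg⟩, rfl⟩
  rw [← heq] at this
  obtain ⟨x, hx⟩ := this
  rw [← hx]

lemma exists_conj_translation [Finite I] [Fintype J] (hJ : Fintype.card J < 3)
    (K : Subgroup (Perm ((I × J) × ZMod 3))) (hb : ∀ g ∈ K, ∀ u, (g u).1.1 = u.1.1)
    (hs : shift I J ∈ K) (c : Perm ((I × J) × ZMod 3)) (hc : c ∈ K) (hc3 : c ^ 3 = 1) :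
    ∃ α ∈ K, ∃ ε : I × J → ZMod 3, ∀ l x, (α * c * α⁻¹) (l, x) = (l, x + ε l) := by
  -- A permutation of three points whose cube is trivial is a translation.
  have key : ∀ f : ZMod 3 → ZMod 3, (∀ x, f (f (f x)) = x) → ∀ x, f x = x + f 0 := by decide
  classical
  have : Fact (Nat.Prime 3) := ⟨Nat.prime_three⟩
  have hz : ∀ g : K, g ^ 3 = 1 → IsPGroup 3 (Subgroup.zpowers g) := by
    intro g hg
    rintro ⟨_, n, rfl⟩
    refine ⟨1, Subtype.ext ?_⟩
    change (g ^ n) ^ (3 ^ 1) = 1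
    rw [pow_one, ← zpow_natCast, ← zpow_mul, mul_comm, zpow_mul, zpow_natCast, hg, one_zpow]
  obtain ⟨P, hP⟩ := (hz ⟨shift I J, hs⟩ (Subtype.ext shift_pow_three)).exists_le_sylow
  obtain ⟨Q, hQ⟩ := (hz ⟨c, hc⟩ (Subtype.ext hc3)).exists_le_sylow
  obtain ⟨g, hg⟩ := MulAction.exists_smul_eq K Q P
  have hcP : g * ⟨c, hc⟩ * g⁻¹ ∈ P := by
    rw [← hg]
    exact ⟨_, hQ (Subgroup.mem_zpowers _), rfl⟩
  have hfst := fst_apply_of_isPGroup hJ ((P : Subgroup K).map K.subtype) (P.2.map _)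
    (by rintro _ ⟨p, -, rfl⟩ u; exact hb _ p.2 u)
    ⟨⟨shift I J, hs⟩, hP (Subgroup.mem_zpowers _), rfl⟩ (g * c * g⁻¹)
    ⟨_, hcP, rfl⟩
  set d : Perm ((I × J) × ZMod 3) := (g : Perm ((I × J) × ZMod 3)) * c * (g : Perm _)⁻¹ with hd
  have hd3 : d ^ 3 = 1 := by rw [hd, conj_pow, hc3]; simp
  refine ⟨g, g.2, fun l => (d (l, 0)).2, fun l x => ?_⟩
  have hdl : ∀ x, d (l, x) = (l, (d (l, x)).2) := fun x => Prod.ext (hfst _) rfl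
  have := key (fun x => (d (l, x)).2) (fun x => by
    have h := congrArg (fun e : Perm _ => (e (l, x)).2) hd3
    simp only [pow_succ, pow_zero, one_mul, Perm.mul_apply, Perm.one_apply] at h
    rw [hdl x, hdl (d (l, x)).2] at h
    exact h) x
  rw [hdl x, this]

/-- The permutation `x ↦ d l - x` in every cell `l ∈ D`, trivial in the other cells. -/
noncomputable def flip (D : Set (I × J)) (d : I × J → ZMod 3) : Perm ((I × J) × ZMod 3) := by
  classical
  exact Function.Involutive.toPerm (fun u => (u.1, if u.1 ∈ D then d u.1 - u.2 else u.2)) (by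
    rintro ⟨l, x⟩
    by_cases h : l ∈ D <;> simp [h])

lemma flip_apply_mem {D : Set (I × J)} (d : I × J → ZMod 3) {l : I × J} (h : l ∈ D)
    (x : ZMod 3) : flip D d (l, x) = (l, d l - x) := by
  simp [flip, Function.Involutive.toPerm, h]

lemma flip_apply_notMem {D : Set (I × J)} (d : I × J → ZMod 3) {l : I × J} (h : l ∉ D)
    (x : ZMod 3) : flip D d (l, x) = (l, x) := by
  simp [flip, Function.Involutive.toPerm, h]

lemma flip_inv (D : Set (I × J)) (d : I × J → ZMod 3) : (flip D d)⁻¹ = flip D d := by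
  rw [flip]; rfl

/-- Whether two vertices in the cells `l` and `k` are related does not depend on the vertices. -/
def Uniform (A : (I × J) × ZMod 3 → (I × J) × ZMod 3 → Prop) (l k : I × J) : Prop :=
  ∀ x y x' y', A (l, x) (k, y) ↔ A (l, x') (k, y')

variable {A : (I × J) × ZMod 3 → (I × J) × ZMod 3 → Prop}

lemma flip_mem_blockAut (hA : ∀ u v, A u v → A v u) {D : Set (I × J)} {d : I × J → ZMod 3}
    (hd : ∀ l ∈ D, ∀ k ∈ D, ∀ x y, A (l, d l - x) (k, d k - y) ↔ A (l, x) (k, y))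
    (hu : ∀ l ∈ D, ∀ k ∉ D, Uniform A l k) : flip D d ∈ blockAut A := by
  have hA' : ∀ u v, A u v ↔ A v u := fun u v => ⟨hA u v, hA v u⟩
  refine ⟨?_, fun u => rfl⟩
  rintro ⟨l, x⟩ ⟨k, y⟩
  by_cases hl : l ∈ D <;> by_cases hk : k ∈ D
  · rw [flip_apply_mem d hl, flip_apply_mem d hk, hd l hl k hk]
  · rw [flip_apply_mem d hl, flip_apply_notMem d hk]
    exact hu l hl k hk _ _ _ _
  · rw [flip_apply_notMem d hl, flip_apply_mem d hk, hA', hA' (l, x)]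
    exact hu k hk l hl _ _ _ _
  · rw [flip_apply_notMem d hl, flip_apply_notMem d hk]

lemma flip_conj {D : Set (I × J)} {d ε : I × J → ZMod 3} {c : Perm ((I × J) × ZMod 3)}
    (hc : ∀ l x, c (l, x) = (l, x + ε l)) (l : I × J) (x : ZMod 3) [Decidable (l ∈ D)] :
    (flip D d * c * (flip D d)⁻¹) (l, x) = (l, x + if l ∈ D then -ε l else ε l) := by
  rw [flip_inv, Perm.mul_apply, Perm.mul_apply]
  by_cases hl : l ∈ D
  · rw [flip_apply_mem d hl, hc, flip_apply_mem d hl, if_pos hl]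
    congr 1; ring
  · rw [flip_apply_notMem d hl, hc, flip_apply_notMem d hl, if_neg hl]

lemma adj_iff_sub (hs : shift I J ∈ blockAut A) (l k : I × J) (x y : ZMod 3) :
    A (l, x) (k, y) ↔ A (l, 0) (k, y - x) := by
  have := ((blockAut A).pow_mem hs x.val).1 (l, 0) (k, y - x)
  rw [shift_pow_apply, shift_pow_apply] at this
  simpa using this

/-- By shift invariance the relation between two cells is a subset of `ZMod 3`. Invariance under `c`
makes that subset stable under adding `ε k - ε l`, a generator of `ZMod 3`, so it is empty or
everything. -/
lemma uniform_of_ne (hs : shift I J ∈ blockAut A) {c : Perm ((I × J) × ZMod 3)}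
    (hcA : c ∈ blockAut A) {ε : I × J → ZMod 3} (hc : ∀ l x, c (l, x) = (l, x + ε l))
    {l k : I × J} (h : ε l ≠ ε k) : Uniform A l k := by
  classical
  have key : ∀ (f : ZMod 3 → Bool) (a : ZMod 3), a ≠ 0 → (∀ z, f (z + a) = f z) →
      ∀ z w, f z = f w := by decide
  have hf := key (fun z => decide (A (l, 0) (k, z))) (ε k - ε l)
    (sub_ne_zero.2 (Ne.symm h)) (fun z => by
      have := hcA.1 (l, 0) (k, z)
      rw [hc, hc, adj_iff_sub hs] at this
      rw [decide_eq_decide, ← this]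
      ring_nf)
  intro x y x' y'
  rw [adj_iff_sub hs l k x, adj_iff_sub hs l k x']
  simpa using hf (y - x) (y' - x')

/-- Every set of at most two blocks admits a reflection of all its cells. -/
def SmallFlips (A : (I × J) × ZMod 3 → (I × J) × ZMod 3 → Prop) : Prop :=
  ∀ B : Finset I, B.card ≤ 2 → ∃ d : I × J → ZMod 3, ∀ l k, l.1 ∈ B → k.1 ∈ B → ∀ x y,
    A (l, d l - x) (k, d k - y) ↔ A (l, x) (k, y)

lemma exists_conj_shift [Fintype I] (hI : Fintype.card I ≤ 5) (hA : ∀ u v, A u v → A v u)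
    (hs : shift I J ∈ blockAut A) (hsmall : SmallFlips A) {c : Perm ((I × J) × ZMod 3)}
    (hcA : c ∈ blockAut A) {ε : I × J → ZMod 3} (hc : ∀ l x, c (l, x) = (l, x + ε l))
    (h0 : ∀ l, ε l ≠ 0) (hε : ∀ i j j', ε (i, j) = ε (i, j')) :
    ∃ α ∈ blockAut A, α * c * α⁻¹ = shift I J ∨ α * c * α⁻¹ = (shift I J)⁻¹ := by
  classical
  have hz : ∀ z w : ZMod 3, z ≠ 0 → w ≠ 0 → z ≠ w → z = -w := by decide
  -- If at most two blocks have sign `s`, reflecting them turns every translation into one by `-s`.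
  have main : ∀ s : ZMod 3, s ≠ 0 →
      (Finset.univ.filter fun i => ∃ j, ε (i, j) = s).card ≤ 2 →
      ∃ α ∈ blockAut A, ∀ l x, (α * c * α⁻¹) (l, x) = (l, x - s) := by
    intro s hs0 hcard
    obtain ⟨d, hd⟩ := hsmall _ hcard
    have hmem : ∀ l : I × J, l.1 ∈ (Finset.univ.filter fun i => ∃ j, ε (i, j) = s) ↔ ε l = s := by
      rintro ⟨i, j⟩
      simp only [Finset.mem_filter, Finset.mem_univ, true_and]
      exact ⟨fun ⟨j', h⟩ => (hε i j j').trans h, fun h => ⟨j, h⟩⟩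
    simp only [hmem] at hd
    refine ⟨flip {l | ε l = s} d, flip_mem_blockAut hA (fun l hl k hk => hd l k hl hk)
      (fun l hl k hk => uniform_of_ne hs hcA hc ?_), fun l x => ?_⟩
    · intro h; exact hk (h.symm.trans hl)
    · rw [flip_conj hc]
      congr 1
      rw [sub_eq_add_neg]
      congr 1
      simp only [Set.mem_ofPred_eq]
      split_ifs with h
      · rw [h]
      · exact hz _ _ (h0 l) hs0 h
  have hdisj : Disjoint (Finset.univ.filter fun i => ∃ j, ε (i, j) = 1)
      (Finset.univ.filter fun i => ∃ j, ε (i, j) = -1) := by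
    rw [Finset.disjoint_filter]
    rintro i - ⟨j, h⟩ ⟨j', h'⟩
    rw [hε i j j', h'] at h
    exact absurd h (by decide)
  have hle := (Finset.card_union_of_disjoint hdisj).symm.trans_le (Finset.card_le_univ _)
  -- This is where five blocks matter: if sign `1` occurs in at least three, sign `-1` occurs in at
  -- most two.
  rcases le_or_gt (Finset.univ.filter fun i => ∃ j, ε (i, j) = 1).card 2 with h | h
  · obtain ⟨α, hα, h⟩ := main 1 (by decide) h
    exact ⟨α, hα, Or.inr (by ext1 ⟨l, x⟩; rw [h, shift_inv_apply])⟩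
  · obtain ⟨α, hα, h⟩ := main (-1) (by decide) (by omega)
    exact ⟨α, hα, Or.inl (by ext1 ⟨l, x⟩; rw [h, shift_apply, sub_neg_eq_add])⟩

lemma exists_reflection_invariant (f : ZMod 3 → Prop) : ∃ τ, ∀ z, f (τ - z) ↔ f z := by
  classical
  have key : ∀ f : ZMod 3 → Bool, ∃ τ, ∀ z, f (τ - z) = f z := by decide
  obtain ⟨τ, h⟩ := key fun z => decide (f z)
  exact ⟨τ, fun z => by simpa using h z⟩

/-- To reflect at most two blocks it suffices to handle the relation from one to the other. -/
lemma smallFlips_of_pairs (hA : ∀ u v, A u v → A v u) (hblock : ∀ u v, u.1.1 = v.1.1 → ¬ A u v)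
    (h : ∀ i i', i ≠ i' → ∃ d d' : J → ZMod 3, ∀ j j' x y,
      A ((i, j), d j - x) ((i', j'), d' j' - y) ↔ A ((i, j), x) ((i', j'), y)) :
    SmallFlips A := by
  classical
  intro B hB
  by_cases hB2 : B.card = 2
  · obtain ⟨i, i', hne, rfl⟩ := Finset.card_eq_two.1 hB2
    obtain ⟨d, d', hd⟩ := h i i' hne
    have hA' : ∀ u v, A u v ↔ A v u := fun u v => ⟨hA u v, hA v u⟩
    refine ⟨fun l => if l.1 = i then d l.2 else d' l.2, ?_⟩
    rintro ⟨a, j⟩ ⟨a', j'⟩ ha ha' x y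
    simp only [Finset.mem_insert, Finset.mem_singleton] at ha ha'
    rcases ha with rfl | rfl <;> rcases ha' with rfl | rfl
    · exact iff_of_false (hblock _ _ rfl) (hblock _ _ rfl)
    · simpa [hne.symm] using hd j j' x y
    · rw [hA', hA' _ ((_, _), y)]
      simpa [hne.symm] using hd j' j y x
    · exact iff_of_false (hblock _ _ rfl) (hblock _ _ rfl)
  · refine ⟨0, fun l k hl hk x y => ?_⟩
    have : l.1 = k.1 := Finset.card_le_one.1 (by omega) _ hl _ hk
    exact iff_of_false (hblock _ _ this) (hblock _ _ this)

theorem exists_conj_shift_of_unit [Fintype I] (hI : Fintype.card I ≤ 5)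
    {A : (I × Unit) × ZMod 3 → (I × Unit) × ZMod 3 → Prop} (hA : ∀ u v, A u v → A v u)
    (hblock : ∀ u v, u.1.1 = v.1.1 → ¬ A u v)
    (hs : shift I Unit ∈ blockAut A) {c : Perm ((I × Unit) × ZMod 3)}
    (hcA : c ∈ blockAut A) (hc3 : c ^ 3 = 1) (hcfix : ∀ u, c u ≠ u) :
    ∃ α ∈ blockAut A, α * c * α⁻¹ = shift I Unit ∨ α * c * α⁻¹ = (shift I Unit)⁻¹ := by
  obtain ⟨α, hα, ε, hε⟩ := exists_conj_translation (by simp) (blockAut A) (fun g hg => hg.2) hs c hcA hc3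
  have h0 : ∀ l, ε l ≠ 0 := by
    intro l hl
    have := hε l 0
    rw [hl, add_zero, Perm.mul_apply, Perm.mul_apply, ← Perm.eq_inv_iff_eq] at this
    exact hcfix _ this
  obtain ⟨β, hβ, h⟩ := exists_conj_shift hI hA hs
    (smallFlips_of_pairs hA hblock fun i i' _ => by
      obtain ⟨τ, hτ⟩ := exists_reflection_invariant fun z => A ((i, ()), 0) ((i', ()), z)
      refine ⟨fun _ => 0, fun _ => τ, fun _ _ x y => ?_⟩
      rw [adj_iff_sub hs, adj_iff_sub hs _ _ x, ← hτ (y - x)]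
      ring_nf)
    ((blockAut A).mul_mem ((blockAut A).mul_mem hα hcA) ((blockAut A).inv_mem hα)) hε h0
    (fun _ _ _ => rfl)
  exact ⟨β * α, (blockAut A).mul_mem hβ hα, by simpa [mul_assoc] using h⟩

end Core

/-! ### Dihedral groups of order 6: two cells per block and a swapping involution. -/

section Dihedral

variable {I : Type*}

/-- The involution exchanging the two cells of each block and negating. -/
def swapNeg (I : Type*) : Perm ((I × Bool) × ZMod 3) :=
  Function.Involutive.toPerm (fun u => ((u.1.1, !u.1.2), -u.2)) (by
    rintro ⟨⟨i, b⟩, x⟩; simp)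

@[simp] lemma swapNeg_apply (i : I) (b : Bool) (x : ZMod 3) :
    swapNeg I ((i, b), x) = ((i, !b), -x) := rfl

/-- A pair of fixed-point-free generators of a dihedral group of order six inside `K`. -/
structure IsDihedralPair {V : Type*} (K : Subgroup (Perm V)) (c t : Perm V) : Prop where
  left_mem : c ∈ K
  right_mem : t ∈ K
  pow_three : c ^ 3 = 1
  mul_self : t * t = 1
  conj : t * c = c⁻¹ * t
  left_ne : ∀ u, c u ≠ u
  right_ne : ∀ u, t u ≠ u

lemma IsDihedralPair.conjBy {V : Type*} {K : Subgroup (Perm V)} {c t : Perm V}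
    (h : IsDihedralPair K c t) {α : Perm V} (hα : α ∈ K) :
    IsDihedralPair K (α * c * α⁻¹) (α * t * α⁻¹) where
  left_mem := K.mul_mem (K.mul_mem hα h.left_mem) (K.inv_mem hα)
  right_mem := K.mul_mem (K.mul_mem hα h.right_mem) (K.inv_mem hα)
  pow_three := by rw [conj_pow, h.pow_three]; simp
  mul_self := by rw [conj_mul, h.mul_self]; simp
  conj := by rw [conj_inv, conj_mul, conj_mul, h.conj]
  left_ne u hu := by
    rw [Perm.mul_apply, Perm.mul_apply, ← Perm.eq_inv_iff_eq] at hu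
    exact h.left_ne _ hu
  right_ne u hu := by
    rw [Perm.mul_apply, Perm.mul_apply, ← Perm.eq_inv_iff_eq] at hu
    exact h.right_ne _ hu

variable {A : (I × Bool) × ZMod 3 → (I × Bool) × ZMod 3 → Prop}

lemma IsDihedralPair.translation_ne_zero {c t : Perm ((I × Bool) × ZMod 3)}
    (h : IsDihedralPair (blockAut A) c t) {ε : I × Bool → ZMod 3}
    (hε : ∀ l x, c (l, x) = (l, x + ε l)) (l : I × Bool) : ε l ≠ 0 := fun hl =>
  h.left_ne (l, 0) (by rw [hε, hl, add_zero])

/-- Since `t` inverts `c`, it is affine on each cell. It cannot keep a cell, for there it would be a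
reflection `x ↦ y - x`, which has the fixed point `-y` in `ZMod 3`. -/
lemma IsDihedralPair.right_apply {c t : Perm ((I × Bool) × ZMod 3)}
    (h : IsDihedralPair (blockAut A) c t) {ε : I × Bool → ZMod 3}
    (hε : ∀ l x, c (l, x) = (l, x + ε l)) (i : I) (b : Bool) :
    ∃ y, ∀ x, t ((i, b), x) = ((i, !b), y - ε (i, b) * ε (i, !b) * x) := by
  have hinv : ∀ l x, c⁻¹ (l, x) = (l, x - ε l) := fun l x => by
    rw [Perm.inv_eq_iff_eq, hε]; simp
  have hstep : ∀ (l : I × Bool) (x : ZMod 3),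
      t (l, x + ε l) = ((t (l, x)).1, (t (l, x)).2 - ε (t (l, x)).1) := fun l x => by
    rw [← hε, ← Perm.mul_apply, h.conj, Perm.mul_apply, ← hinv]
  have hsq : ∀ z : ZMod 3, z ≠ 0 → z * z = 1 := by decide
  have hn : ∀ (l : I × Bool) (n : ℕ),
      t (l, n * ε l) = ((t (l, 0)).1, (t (l, 0)).2 - n * ε (t (l, 0)).1) := by
    intro l n
    induction n with
    | zero => simp
    | succ n ih =>
      have := hstep l (n * ε l)
      rw [ih] at this
      push_cast
      rw [add_mul, one_mul, this]
      simp only [add_mul, one_mul, sub_sub]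
  have hall : ∀ (l : I × Bool) (x : ZMod 3),
      t (l, x) = ((t (l, 0)).1, (t (l, 0)).2 - ε l * ε (t (l, 0)).1 * x) := by
    intro l x
    have := hn l (x * ε l).val
    rw [ZMod.natCast_zmod_val, mul_assoc, hsq _ (h.translation_ne_zero hε l), mul_one] at this
    rw [this]
    congr 2; ring
  have hfst : (t ((i, b), 0)).1 = (i, !b) := by
    refine Prod.ext (h.right_mem.2 _) ?_
    by_contra hne
    have heq : (t ((i, b), 0)).1 = (i, b) := by
      refine Prod.ext (h.right_mem.2 _) ?_
      cases b <;> simpa using hne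
    have := hall (i, b) (-(t ((i, b), 0)).2)
    rw [heq, hsq _ (h.translation_ne_zero hε _)] at this
    refine h.right_ne _ (this.trans ?_)
    congr 1
    generalize (t ((i, b), 0)).2 = y
    revert y; decide
  exact ⟨(t ((i, b), 0)).2, fun x => by rw [hall, hfst]⟩

/-- In each block whose two cells have opposite signs, the cell of sign `-1` is reflected. On these
cells the reflection coincides with `t * swapNeg I`, so it respects the edges among them. -/
lemma exists_conj_blockwise (hA : ∀ u v, A u v → A v u)
    (hs : shift I Bool ∈ blockAut A) (ht : swapNeg I ∈ blockAut A)
    {c t : Perm ((I × Bool) × ZMod 3)} (h : IsDihedralPair (blockAut A) c t)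
    {ε : I × Bool → ZMod 3} (hε : ∀ l x, c (l, x) = (l, x + ε l)) :
    ∃ α ∈ blockAut A, ∃ η : I × Bool → ZMod 3,
      (∀ l x, (α * c * α⁻¹) (l, x) = (l, x + η l)) ∧ ∀ i b b', η (i, b) = η (i, b') := by
  have key : ∀ z w : ZMod 3, z ≠ 0 → w ≠ 0 →
      (if z = -1 ∧ w = 1 then -z else z) = (if w = -1 ∧ z = 1 then -w else w) := by decide
  classical
  have h0 := h.translation_ne_zero hε
  choose y hy using h.right_apply hε
  set D : Set (I × Bool) := {l | ε l = -1 ∧ ε (l.1, !l.2) = 1} with hD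
  let d : I × Bool → ZMod 3 := fun l => y l.1 (!l.2)
  have hflip : ∀ l ∈ D, ∀ x, (t * swapNeg I) (l, x) = (l, d l - x) := by
    rintro ⟨i, b⟩ ⟨h1, h2⟩ x
    simp only at h2
    rw [Perm.mul_apply, swapNeg_apply, hy]
    simp [d, h1, h2, sub_eq_add_neg]
  refine ⟨flip D d, flip_mem_blockAut hA ?_ ?_, _, fun l x => flip_conj hε l x, ?_⟩
  · intro l hl k hk x x'
    rw [← hflip l hl, ← hflip k hk]
    exact ((blockAut A).mul_mem h.right_mem ht).1 _ _
  · rintro ⟨i, b⟩ ⟨h1, h2⟩ ⟨k, b'⟩ hk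
    by_cases hk1 : ε (k, b') = -1
    · have hk2 : ε (k, !b') ≠ 1 := fun h' => hk ⟨hk1, h'⟩
      have hu : Uniform A (i, !b) (k, !b') :=
        uniform_of_ne hs h.left_mem hε (fun h' => hk2 (h'.symm.trans h2))
      intro x x' z z'
      rw [← ht.1 _ (_, x'), ← ht.1 _ (_, z')]
      exact hu _ _ _ _
    · exact uniform_of_ne hs h.left_mem hε (fun h' => hk1 (h'.symm.trans h1))
  · have hne : ∀ i b, (if (i, b) ∈ D then -ε (i, b) else ε (i, b)) =
        (if (i, !b) ∈ D then -ε (i, !b) else ε (i, !b)) := by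
      intro i b
      have := key _ _ (h0 (i, b)) (h0 (i, !b))
      simpa [hD] using this
    intro i b b'
    by_cases hb : b = b'
    · rw [hb]
    · obtain rfl : b' = !b := by cases b <;> cases b' <;> simp_all
      exact hne i b

lemma smallFlips_of_swapNeg (hA : ∀ u v, A u v → A v u)
    (hblock : ∀ u v, u.1.1 = v.1.1 → ¬ A u v)
    (hs : shift I Bool ∈ blockAut A) (ht : swapNeg I ∈ blockAut A) : SmallFlips A := by
  refine smallFlips_of_pairs hA hblock fun i i' _ => ?_
  obtain ⟨τ, hτ⟩ := exists_reflection_invariant fun z => A ((i, false), 0) ((i', false), z)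
  obtain ⟨υ, hυ⟩ := exists_reflection_invariant fun z => A ((i, false), 0) ((i', true), z)
  have hneg : ∀ b b' z, A ((i, !b), 0) ((i', !b'), z) ↔ A ((i, b), 0) ((i', b'), -z) := by
    intro b b' z
    rw [← ht.1 ((i, b), 0)]
    simp
  have hft := hneg false false
  have htf := hneg false true
  simp only [Bool.not_false, Bool.not_true] at hft htf
  -- By `swapNeg`, the other two connection sets are the negatives of these, so they are symmetric
  -- about `-τ` and `-υ`. The differences `d' b' - d b` must therefore be `τ`, `υ`, `-υ`, `-τ`, and
  -- these four conditions are consistent.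
  refine ⟨fun b => if b then υ + τ else 0, fun b => if b then υ else τ, fun b b' x y => ?_⟩
  rw [adj_iff_sub hs, adj_iff_sub hs _ _ x]
  cases b <;> cases b' <;> simp only [if_true, Bool.false_eq_true, if_false]
  · rw [← hτ (y - x)]; ring_nf
  · rw [← hυ (y - x)]; ring_nf
  · rw [htf, htf, ← hυ]; ring_nf
  · rw [hft, hft, ← hτ]; ring_nf

theorem exists_conj_shift_swapNeg [Fintype I] (hI : Fintype.card I ≤ 5)
    (hA : ∀ u v, A u v → A v u) (hblock : ∀ u v, u.1.1 = v.1.1 → ¬ A u v)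
    (hs : shift I Bool ∈ blockAut A) (ht : swapNeg I ∈ blockAut A)
    {c t : Perm ((I × Bool) × ZMod 3)} (h : IsDihedralPair (blockAut A) c t) :
    ∃ α ∈ blockAut A, (α * c * α⁻¹ = shift I Bool ∨ α * c * α⁻¹ = (shift I Bool)⁻¹) ∧
      α * t * α⁻¹ = swapNeg I := by
  obtain ⟨α₁, hα₁, ε, hε⟩ :=
    exists_conj_translation (by simp) (blockAut A) (fun g hg => hg.2) hs c h.left_mem h.pow_three
  have h₁ := h.conjBy hα₁
  obtain ⟨α₂, hα₂, η, hη, hηb⟩ := exists_conj_blockwise hA hs ht h₁ hε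
  have h₂ := h₁.conjBy hα₂
  obtain ⟨α₃, hα₃, h₃s⟩ := exists_conj_shift hI hA hs (smallFlips_of_swapNeg hA hblock hs ht)
    h₂.left_mem hη (h₂.translation_ne_zero hη) hηb
  have h₃ := h₂.conjBy hα₃
  set c₃ := α₃ * (α₂ * (α₁ * c * α₁⁻¹) * α₂⁻¹) * α₃⁻¹ with hc₃
  set t₃ := α₃ * (α₂ * (α₁ * t * α₁⁻¹) * α₂⁻¹) * α₃⁻¹ with ht₃
  have hδ : ∃ δ : ZMod 3, δ * δ = 1 ∧ ∀ l x, c₃ (l, x) = (l, x + δ) := by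
    rcases h₃s with h | h <;> rw [h]
    · exact ⟨1, by decide, fun l x => rfl⟩
    · exact ⟨-1, by decide, fun l x => by rw [shift_inv_apply, sub_eq_add_neg]⟩
  obtain ⟨δ, hδ1, hδ⟩ := hδ
  choose y hy using h₃.right_apply (ε := fun _ => δ) hδ
  simp only [hδ1, one_mul] at hy
  have hyy : ∀ i b, y i (!b) = y i b := by
    intro i b
    have := congrArg (fun g : Perm _ => g ((i, b), 0)) h₃.mul_self
    simp only [Perm.mul_apply, hy, Perm.one_apply, Prod.mk.injEq] at this
    simpa [sub_eq_zero] using this.2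
  -- The product `w = t₃ * swapNeg I` translates both cells of a block equally. So it commutes with
  -- `c₃`, and since `w ^ 3 = 1` for this product of two involutions, it conjugates `t₃` to `swapNeg
  -- I`.
  have hw : ∀ i b x, (t₃ * swapNeg I) ((i, b), x) = ((i, b), x + y i b) := by
    intro i b x
    rw [Perm.mul_apply, swapNeg_apply, hy, hyy, Bool.not_not]
    congr 1; ring
  have hwc : (t₃ * swapNeg I) * c₃ = c₃ * (t₃ * swapNeg I) := by
    ext1 ⟨⟨i, b⟩, x⟩
    rw [Perm.mul_apply _ c₃, Perm.mul_apply c₃, hδ, hw, hw, hδ]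
    congr 1; ring
  have hwt : (t₃ * swapNeg I) * t₃ = swapNeg I * (t₃ * swapNeg I) := by
    ext1 ⟨⟨i, b⟩, x⟩
    rw [Perm.mul_apply _ t₃, Perm.mul_apply (swapNeg I), hy, hw, hw, swapNeg_apply, hyy]
    congr 1
    generalize y i b = z
    revert x z; decide
  refine ⟨(t₃ * swapNeg I) * (α₃ * α₂ * α₁), (blockAut A).mul_mem
    ((blockAut A).mul_mem h₃.right_mem ht)
    ((blockAut A).mul_mem ((blockAut A).mul_mem hα₃ hα₂) hα₁), ?_, ?_⟩
  · have : (t₃ * swapNeg I) * (α₃ * α₂ * α₁) * c * ((t₃ * swapNeg I) * (α₃ * α₂ * α₁))⁻¹ =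
        (t₃ * swapNeg I) * c₃ * (t₃ * swapNeg I)⁻¹ := by
      rw [hc₃]; group
    rw [this, hwc, mul_inv_cancel_right]
    exact h₃s
  · have : (t₃ * swapNeg I) * (α₃ * α₂ * α₁) * t * ((t₃ * swapNeg I) * (α₃ * α₂ * α₁))⁻¹ =
        (t₃ * swapNeg I) * t₃ * (t₃ * swapNeg I)⁻¹ := by
      nth_rw 4 [ht₃]; group
    rw [this, hwt, mul_inv_cancel_right]

end Dihedral

/-! ### From conjugacy in the automorphism group to an element of the normalizer. -/

section Transfer

variable {G : Type*} [Group G] {m : ℕ} {I J : Type*}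

lemma IsMPCayleyGraph.not_adj {Γ : SimpleGraph (Fin m × G)} (h : IsMPCayleyGraph Γ)
    {u v : Fin m × G} (huv : u.1 = v.1) : ¬ Γ.Adj u v := by
  obtain ⟨S, hS, hΓ⟩ := h
  rw [hΓ]
  rintro ⟨s, hs, -⟩
  rw [huv, hS] at hs
  exact hs

lemma IsMPCayleyGraph.adj_rightMul {Γ : SimpleGraph (Fin m × G)} (h : IsMPCayleyGraph Γ) (g : G)
    (u v : Fin m × G) : Γ.Adj (rightMul m g u) (rightMul m g v) ↔ Γ.Adj u v := by
  obtain ⟨S, hS, hΓ⟩ := h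
  simp [hΓ, Arc, rightMul, ← mul_assoc]

lemma rightMul_ne {g : G} (hg : g ≠ 1) (u : Fin m × G) : rightMul m g u ≠ u := fun h =>
  hg (by simpa [rightMul] using congrArg Prod.snd h)

/-- The relation on `(I × J) × ZMod 3` corresponding to the adjacency of `Γ` under `e`. -/
def transferAdj (e : Fin m × G ≃ (I × J) × ZMod 3) (Γ : SimpleGraph (Fin m × G))
    (u v : (I × J) × ZMod 3) : Prop :=
  Γ.Adj (e.symm u) (e.symm v)

variable {Γ Γ' : SimpleGraph (Fin m × G)} (e : Fin m × G ≃ (Fin m × J) × ZMod 3)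

lemma permCongr_conj_mem_blockAut (he : ∀ u, (e u).1.1 = u.1) (hΓ' : IsMPCayleyGraph Γ')
    (σ : Γ ≃g Γ') (hσ : ∀ i : Fin m, ∃ j : Fin m, σ '' block G i = block G j) (g : G) :
    e.permCongrHom (σ.toEquiv⁻¹ * rightMul m g * σ.toEquiv) ∈ blockAut (transferAdj e Γ) := by
  have happ : ∀ u, e.permCongrHom (σ.toEquiv⁻¹ * rightMul m g * σ.toEquiv) u =
      e (σ.symm (rightMul m g (σ (e.symm u)))) := fun u => rfl
  refine ⟨fun u v => ?_, fun u => ?_⟩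
  · rw [happ, happ, transferAdj, transferAdj, e.symm_apply_apply, e.symm_apply_apply,
      σ.symm.map_adj_iff, hΓ'.adj_rightMul, σ.map_adj_iff]
  · rw [happ, he]
    obtain ⟨w, rfl⟩ := e.surjective u
    rw [he, e.symm_apply_apply]
    -- Although `σ` may permute the blocks, the conjugate fixes each one because `rightMul m g`
    -- does.
    obtain ⟨j, hj⟩ := hσ w.1
    have h1 : σ w ∈ block G j := hj ▸ ⟨w, rfl, rfl⟩
    have h2 : rightMul m g (σ w) ∈ block G j := h1
    rw [← hj] at h2
    obtain ⟨z, hz, hz'⟩ := h2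
    rw [← hz', RelIso.symm_apply_apply]
    exact hz

lemma permCongr_rightMul_mem_blockAut (he : ∀ u, (e u).1.1 = u.1) (hΓ : IsMPCayleyGraph Γ)
    (g : G) : e.permCongrHom (rightMul m g) ∈ blockAut (transferAdj e Γ) := by
  have := permCongr_conj_mem_blockAut e he hΓ (RelIso.refl Γ.Adj) (fun i => ⟨i, by simp⟩) g
  exact this

lemma permCongr_conj_ne (σ : Γ ≃g Γ') {g : G} (hg : g ≠ 1) (u : (Fin m × J) × ZMod 3) :
    e.permCongrHom (σ.toEquiv⁻¹ * rightMul m g * σ.toEquiv) u ≠ u := by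
  intro h
  have h' : e (σ.symm (rightMul m g (σ (e.symm u)))) = u := h
  rw [← e.eq_symm_apply, RelIso.symm_apply_eq] at h'
  exact rightMul_ne hg _ h'

/-- Allowing inverses is essential: conjugation in `K` only brings the order-3 generator to the
shift or its inverse. -/
lemma mem_normalizer_of_closure {V : Type*} [Group V] {R : Subgroup V} {T : Set V}
    (hT : R = Subgroup.closure T) {n : V}
    (h : ∀ g ∈ T, n⁻¹ * g * n = g ∨ n⁻¹ * g * n = g⁻¹) :
    n ∈ Subgroup.normalizer (R : Set V) := by
  have hTR : T ⊆ R := hT ▸ Subgroup.subset_closure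
  rw [Subgroup.mem_normalizer_iff'']
  intro x
  constructor
  · intro hx
    have hle : R ≤ R.comap (MulAut.conj n⁻¹).toMonoidHom := by
      conv_lhs => rw [hT]
      rw [Subgroup.closure_le]
      intro g hg
      change n⁻¹ * g * n⁻¹⁻¹ ∈ R
      rw [inv_inv]
      rcases h g hg with h | h <;> rw [h]
      exacts [hTR hg, R.inv_mem (hTR hg)]
    simpa using hle hx
  · intro hx
    have hle : R ≤ R.comap (MulAut.conj n).toMonoidHom := by
      conv_lhs => rw [hT]
      rw [Subgroup.closure_le]
      intro g hg
      change n * g * n⁻¹ ∈ R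
      rcases h g hg with h | h
      · have : n * g * n⁻¹ = g := by nth_rw 1 [← h]; group
        rw [this]; exact hTR hg
      · have hg' : g = (n⁻¹ * g * n)⁻¹ := by rw [h, inv_inv]
        have : n * g * n⁻¹ = g⁻¹ := by nth_rw 1 [hg']; group
        rw [this]; exact R.inv_mem (hTR hg)
    have := hle hx
    change n * (n⁻¹ * x * n) * n⁻¹ ∈ R at this
    convert this using 1
    group

lemma exists_mem_normalizer_of_conj {T : Set (Perm (Fin m × G))}
    (hT : rightMulGroup m G = Subgroup.closure T) (σ : Γ ≃g Γ')
    {α : Perm ((Fin m × J) × ZMod 3)} (hα : α ∈ blockAut (transferAdj e Γ))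
    (h : ∀ g ∈ T, α * e.permCongrHom (σ.toEquiv⁻¹ * g * σ.toEquiv) * α⁻¹ = e.permCongrHom g ∨
      α * e.permCongrHom (σ.toEquiv⁻¹ * g * σ.toEquiv) * α⁻¹ = (e.permCongrHom g)⁻¹) :
    ∃ n ∈ Subgroup.normalizer (rightMulGroup m G : Set (Perm (Fin m × G))), image n Γ = Γ' := by
  obtain ⟨a, hαa⟩ : ∃ a, α = e.permCongrHom a :=
    ⟨_, (e.permCongrHom.apply_symm_apply α).symm⟩
  have hadj : ∀ u v, Γ.Adj (a u) (a v) ↔ Γ.Adj u v := by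
    intro u v
    have : Γ.Adj (e.symm (α (e u))) (e.symm (α (e v))) ↔ Γ.Adj (e.symm (e u)) (e.symm (e v)) :=
      hα.1 (e u) (e v)
    simpa [hαa] using this
  refine ⟨σ.toEquiv * a⁻¹, mem_normalizer_of_closure hT fun g hg => ?_, ?_⟩
  · have h' := h g hg
    rw [hαa, ← map_inv, ← map_inv, ← map_mul, ← map_mul, e.permCongrHom.injective.eq_iff,
      e.permCongrHom.injective.eq_iff] at h'
    simpa [mul_assoc] using h'
  · have hn : ∀ u v, Γ'.Adj ((σ.toEquiv * a⁻¹) u) ((σ.toEquiv * a⁻¹) v) ↔ Γ.Adj u v := by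
      intro u v
      have h1 : Γ'.Adj ((σ.toEquiv * a⁻¹) u) ((σ.toEquiv * a⁻¹) v) ↔ Γ.Adj (a⁻¹ u) (a⁻¹ v) :=
        σ.map_adj_iff
      rw [h1, ← hadj]
      simp
    generalize σ.toEquiv * a⁻¹ = n at hn
    ext u v
    rw [image, SimpleGraph.map_adj']
    constructor
    · rintro ⟨-, u', v', h, rfl, rfl⟩
      exact (hn _ _).2 h
    · intro h
      refine ⟨h.ne, n⁻¹ u, n⁻¹ v, ?_, by simp, by simp⟩
      rw [← hn]
      simpa using h

end Transfer

/-! ### The two groups in cell coordinates. -/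

section Groups

variable {m : ℕ}

lemma rightMul_mul {G : Type*} [Group G] (g h : G) :
    rightMul m g * rightMul m h = rightMul m (h * g) := by
  ext u <;> simp [rightMul, mul_assoc]

lemma rightMul_one {G : Type*} [Group G] : rightMul m (1 : G) = 1 := by
  ext u <;> simp [rightMul]

lemma rightMul_pow {G : Type*} [Group G] (g : G) (n : ℕ) :
    rightMul m g ^ n = rightMul m (g ^ n) := by
  induction n with
  | zero => simp [rightMul_one]
  | succ n ih => rw [pow_succ, ih, rightMul_mul, pow_succ']

lemma rightMul_inv {G : Type*} [Group G] (g : G) : (rightMul m g)⁻¹ = rightMul m g⁻¹ := by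
  rw [inv_eq_iff_mul_eq_one, rightMul_mul, inv_mul_cancel, rightMul_one]

/-- The cells of the cyclic group of order three are the blocks. -/
def cyclicCells (m : ℕ) : Fin m × Multiplicative (ZMod 3) ≃ (Fin m × Unit) × ZMod 3 where
  toFun u := ((u.1, ()), u.2.toAdd)
  invFun u := (u.1.1, Multiplicative.ofAdd u.2)
  left_inv _ := rfl
  right_inv _ := rfl

lemma rightMulGroup_cyclic : rightMulGroup m (Multiplicative (ZMod 3)) =
    Subgroup.closure {rightMul m (Multiplicative.ofAdd (1 : ZMod 3))} := by
  apply le_antisymm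
  · rintro _ ⟨g, rfl⟩
    have hg : ∀ x : ZMod 3, Multiplicative.ofAdd (1 : ZMod 3) ^ x.val = Multiplicative.ofAdd x :=
      fun x => by rw [← ofAdd_nsmul, nsmul_eq_mul, mul_one, ZMod.natCast_zmod_val]
    rw [← ofAdd_toAdd g, ← hg g.toAdd, ← rightMul_pow]
    exact Subgroup.pow_mem _ (Subgroup.mem_closure_singleton_self _) _
  · rw [Subgroup.closure_le, Set.singleton_subset_iff]
    exact ⟨_, rfl⟩

theorem isMPCIGroup_cyclic (hm : m ≤ 5) : IsMPCIGroup m (Multiplicative (ZMod 3)) := by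
  rintro Γ hΓ Γ' hΓ' ⟨σ, hσ⟩
  have he : ∀ u, (cyclicCells m u).1.1 = u.1 := fun _ => rfl
  have hshift : (cyclicCells m).permCongrHom (rightMul m (Multiplicative.ofAdd (1 : ZMod 3))) =
      shift (Fin m) Unit := rfl
  have hone : Multiplicative.ofAdd (1 : ZMod 3) ≠ 1 := by decide
  have hcube : Multiplicative.ofAdd (1 : ZMod 3) ^ 3 = 1 := by decide
  obtain ⟨α, hα, h⟩ := exists_conj_shift_of_unit (by simpa using hm)
    (A := transferAdj (cyclicCells m) Γ) (fun u v h => Γ.adj_symm h)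
    (fun u v h => hΓ.not_adj h)
    (hshift ▸ permCongr_rightMul_mem_blockAut (cyclicCells m) he hΓ _)
    (permCongr_conj_mem_blockAut (cyclicCells m) he hΓ' σ hσ _)
    (by
      have := conj_pow (i := 3) (a := σ.toEquiv⁻¹)
        (b := rightMul m (Multiplicative.ofAdd (1 : ZMod 3)))
      rw [inv_inv] at this
      rw [← map_pow, this, rightMul_pow, hcube, rightMul_one, mul_one, inv_mul_cancel, map_one])
    (permCongr_conj_ne (cyclicCells m) σ hone)
  refine exists_mem_normalizer_of_conj (cyclicCells m) rightMulGroup_cyclic σ hα ?_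
  rintro _ rfl
  rw [hshift]
  exact h

/-- The cells of the dihedral group of order six are the cosets of the rotations. -/
def dihedralCells (m : ℕ) : Fin m × DihedralGroup 3 ≃ (Fin m × Bool) × ZMod 3 where
  toFun
    | (i, .r x) => ((i, false), x)
    | (i, .sr x) => ((i, true), x)
  invFun
    | ((i, false), x) => (i, .r x)
    | ((i, true), x) => (i, .sr x)
  left_inv := by rintro ⟨i, x | x⟩ <;> rfl
  right_inv := by rintro ⟨⟨i, _ | _⟩, x⟩ <;> rfl

lemma rightMulGroup_dihedral : rightMulGroup m (DihedralGroup 3) =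
    Subgroup.closure {rightMul m (DihedralGroup.r (1 : ZMod 3)), rightMul m (DihedralGroup.sr (0 : ZMod 3))} := by
  apply le_antisymm
  · have hr : ∀ x : ZMod 3, rightMul m (DihedralGroup.r x) ∈
        Subgroup.closure {rightMul m (DihedralGroup.r (1 : ZMod 3)), rightMul m (DihedralGroup.sr (0 : ZMod 3))} := by
      intro x
      have : DihedralGroup.r x = DihedralGroup.r 1 ^ x.val := by
        rw [DihedralGroup.r_one_pow]; simp
      rw [this, ← rightMul_pow]
      exact Subgroup.pow_mem _ (Subgroup.subset_closure (by simp)) _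
    rintro _ ⟨x | x, rfl⟩
    · exact hr x
    · have : (DihedralGroup.sr x : DihedralGroup 3) = DihedralGroup.sr 0 * DihedralGroup.r x := by simp
      rw [this, ← rightMul_mul]
      exact Subgroup.mul_mem _ (hr x) (Subgroup.subset_closure (by simp))
  · rw [Subgroup.closure_le]
    rintro _ (rfl | rfl) <;> exact ⟨_, rfl⟩

theorem isMPCIGroup_dihedral (hm : m ≤ 5) : IsMPCIGroup m (DihedralGroup 3) := by
  rintro Γ hΓ Γ' hΓ' ⟨σ, hσ⟩
  set e := dihedralCells m with hedef
  have he : ∀ u, (e u).1.1 = u.1 := by rintro ⟨i, x | x⟩ <;> rfl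
  have hshift : e.permCongrHom (rightMul m (DihedralGroup.r (1 : ZMod 3))) = shift (Fin m) Bool := by
    ext1 ⟨⟨i, _ | _⟩, x⟩ <;> rfl
  have hswap : e.permCongrHom (rightMul m (DihedralGroup.sr (0 : ZMod 3))) = swapNeg (Fin m) := by
    ext1 ⟨⟨i, _ | _⟩, x⟩
    · change ((i, true), 0 - x) = ((i, true), -x)
      rw [zero_sub]
    · change ((i, false), 0 - x) = ((i, false), -x)
      rw [zero_sub]
  set f : Perm (Fin m × DihedralGroup 3) →* Perm ((Fin m × Bool) × ZMod 3) :=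
    e.permCongrHom.toMonoidHom.comp (MulAut.conj σ.toEquiv⁻¹).toMonoidHom with hf
  have hfapp : ∀ g, e.permCongrHom (σ.toEquiv⁻¹ * g * σ.toEquiv) = f g := fun g => rfl
  have hpair : IsDihedralPair (blockAut (transferAdj e Γ))
      (f (rightMul m (DihedralGroup.r (1 : ZMod 3)))) (f (rightMul m (DihedralGroup.sr (0 : ZMod 3)))) :=
    { left_mem := permCongr_conj_mem_blockAut e he hΓ' σ hσ _
      right_mem := permCongr_conj_mem_blockAut e he hΓ' σ hσ _
      pow_three := by
        rw [← map_pow, rightMul_pow, show (DihedralGroup.r 1 : DihedralGroup 3) ^ 3 = 1 by decide,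
          rightMul_one, map_one]
      mul_self := by
        rw [← map_mul, rightMul_mul, DihedralGroup.sr_mul_self, rightMul_one, map_one]
      conj := by
        rw [← map_inv, ← map_mul, ← map_mul, rightMul_inv, rightMul_mul, rightMul_mul]
        congr 2
      left_ne := permCongr_conj_ne e σ (by decide)
      right_ne := permCongr_conj_ne e σ (by decide) }
  obtain ⟨α, hα, h1, h2⟩ := exists_conj_shift_swapNeg (by simpa using hm)
    (A := transferAdj e Γ) (fun u v h => Γ.adj_symm h)
    (fun u v h => hΓ.not_adj (by rw [← he, ← he]; simpa using h))
    (hshift ▸ permCongr_rightMul_mem_blockAut e he hΓ _)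
    (hswap ▸ permCongr_rightMul_mem_blockAut e he hΓ _) hpair
  refine exists_mem_normalizer_of_conj e rightMulGroup_dihedral σ hα ?_
  rintro _ (rfl | rfl)
  · rw [hshift, hfapp]; exact h1
  · rw [hswap, hfapp]; exact Or.inl h2

end Groups

end MCayley

theorem mainTheorem10 (m : ℕ) (hm : 1 ≤ m) (hm5 : m ≤ 5) :
    MCayley.IsMPCIGroup m (Multiplicative (ZMod 3)) ∧
      MCayley.IsMPCIGroup m (DihedralGroup 3) :=
  ⟨MCayley.isMPCIGroup_cyclic hm5, MCayley.isMPCIGroup_dihedral hm5⟩
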